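/- Let $n\ge 1$ and let $a_{ij}:[0,\infty)\to[0,\infty)$, $i,j\in\{1,\dots,n\}$, be measurable functions that are cut-balanced: there is a constant $K\ge 1$ such that for all $t\ge 0$ and all nonempty proper subsets $S$ of $\{1,\dots,n\}$, $$K^{-1}\sum_{i\in S,\,j\notin S}a_{ji}(t)\;\le\;\sum_{i\in S,\,j\notin S}a_{ij}(t)\;\le\;K\sum_{i\in S,\,j\notin S}a_{ji}(t).$$ Let $G$ be the directed graph on $\{1,\dots,n\}$ in which $(j,i)$ is an edge if and only if $\int_0^\infty a_{ij}(t)\,dt=\infty$. A solution is a function $x:[0,\infty)\to\mathbb{R}^n$ such that, for all $i$ and all $t\ge 0$, the function $\sum_j a_{ij}(x_j-x_i)$ is Lebesgue integrable on $[0,t]$ and $$x_i(t)=x_i(0)+\int_0^t\sum_{j=1}^n a_{ij}(\tau)\bigl(x_j(\tau)-x_i(\tau)\bigr)\,d\tau .$$ (a) For every solution $x$ and every $i$, the limit $x_i^*=\lim_{t\to\infty}x_i(t)$ exists, and $x_i^*\in[\min_j x_j(0),\max_j x_j(0)]$. (b) Every weakly connected component of $G$ is strongly connected. If, in addition, $\int_0^T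 a_{ij}(t)\,dt<\infty$ for all $i,j$ and all $T<\infty$, then: (c) For every solution $x$ and all $i,j$, $\int_0^\infty a_{ij}(t)\,|x_j(t)-x_i(t)|\,dt<\infty$; and if $i$ and $j$ belong to the same (weakly) connected component of $G$, then $x_i^*=x_j^*$. (d) For all $i,j$ that belong to different connected components of $G$ there is an $(n-1)$-dimensional linear subspace $V_{ij}$ of $\mathbb{R}^n$, which depends only on $i$, $j$ and the functions $a_{kl}$, such that $x_i^*\ne x_j^*$ for every solution $x$ with $x(0)\notin V_{ij}$. -/

import Mathlib

open Set Filter Topology MeasureTheory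

noncomputable section

namespace Consensus

/-- Interaction coefficients `a i j t`, used only at times `t ≥ 0`: nonnegative and
(Lebesgue) measurable on `[0, ∞)`. -/
structure IsCoefficients {n : ℕ} (a : Fin n → Fin n → ℝ → ℝ) : Prop where
  nonneg : ∀ i j t, 0 ≤ t → 0 ≤ a i j t
  aemeasurable : ∀ i j, AEMeasurable (a i j) (volume.restrict (Ici 0))

/-- Cut-balance, with one constant `K ≥ 1` for all times and all nonempty proper subsets. -/
def CutBalanced {n : ℕ} (a : Fin n → Fin n → ℝ → ℝ) : Prop :=
  ∃ K : ℝ, 1 ≤ K ∧ ∀ t : ℝ, 0 ≤ t → ∀ S : Finset (Fin n), S.Nonempty → S ≠ Finset.univ →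
    K⁻¹ * ∑ i ∈ S, ∑ j ∈ Sᶜ, a j i t ≤ ∑ i ∈ S, ∑ j ∈ Sᶜ, a i j t ∧
      ∑ i ∈ S, ∑ j ∈ Sᶜ, a i j t ≤ K * ∑ i ∈ S, ∑ j ∈ Sᶜ, a j i t

/-- Boundedness: `∫₀ᵀ a i j < ∞` for every finite `T`. -/
def LocallyBounded {n : ℕ} (a : Fin n → Fin n → ℝ → ℝ) : Prop :=
  ∀ i j, ∀ T : ℝ, ∫⁻ t in Icc 0 T, ENNReal.ofReal (a i j t) < ⊤

/-- `x : [0, ∞) → ℝⁿ` (only the values at times `t ≥ 0` matter) solves the system of integral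
equations `x_i(t) = x_i(0) + ∫₀ᵗ ∑_j a_ij (x_j - x_i)`; the integrability clause says that the
integrals on the right-hand side exist as Lebesgue integrals. -/
def IsSolution {n : ℕ} (a : Fin n → Fin n → ℝ → ℝ) (x : ℝ → Fin n → ℝ) : Prop :=
  ∀ i, ∀ t : ℝ, 0 ≤ t →
    IntervalIntegrable (fun τ => ∑ j, a i j τ * (x τ j - x τ i)) volume 0 t ∧
      x t i = x 0 i + ∫ τ in (0 : ℝ)..t, ∑ j, a i j τ * (x τ j - x τ i)

/-- The unbounded interactions graph: `(j, i)` is an edge iff `∫₀^∞ a i j = ∞`. -/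
def unboundedGraph {n : ℕ} (a : Fin n → Fin n → ℝ → ℝ) : Digraph (Fin n) where
  Adj j i := ∫⁻ t in Ici 0, ENNReal.ofReal (a i j t) = ⊤

/-- The weakly connected components of a directed graph: the connected components of the
undirected graph in which the orientation of the edges is forgotten. -/
abbrev WeakComponent {V : Type*} (G : Digraph V) : Type _ :=
  G.toSimpleGraphInclusive.ConnectedComponent

/-- The weakly connected component of a vertex. -/
abbrev weakComponent {V : Type*} (G : Digraph V) (v : V) : WeakComponent G :=
  G.toSimpleGraphInclusive.connectedComponentMk v

/-- The subgraph of `G` induced on the vertex set `s` is strongly connected: any vertex of `s` can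
be reached from any other one by a directed path of `G` inside `s`. -/
def StronglyConnectedOn {V : Type*} (G : Digraph V) (s : Set V) : Prop :=
  ∀ u v : s, Relation.ReflTransGen (fun p q : s => G.Adj p q) u v

end Consensus

end

namespace Consensus

/-! Sort the coordinates increasingly and give the k-th smallest (from k = 0) the weight q^k, q =
1/(2K). Across each gap between consecutive sorted values, cut-balance bounds the downward pull on
the upper group by K times the upward pull on the lower group, while the weight drops by the factor
q. Hence the weighted sum grows at least at the rate c Σ a_ij |x_j - x_i| (`sum_weighted_diff_ge`).
By rearrangement it is the minimum of Σ q^k x_{σ(k)} over permutations σ, so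
`add_integral_le_of_envelope` integrates this rate without tracking the crossings of trajectories.
The sum is bounded above, so all interactions, and with them all drifts, are integrable on [0, ∞),
and limits exist.

For (b), cut-balance prevents a set without outgoing edges from having incoming ones. For (c),
distinct limits across an edge would make its coefficient integrable. For (d), the initial states of
solutions with x_i^* = x_j^* form a subspace. If it were everything, backward uniqueness would make
the states at any later T everything too; but for late T the remaining interaction between
components is too weak to close the gap of a solution that equals the indicator of a component at T.
-/

/-! ### Growth of a minimum of finitely many primitives -/

/-- A function whose increments are dominated by those of an absolutely continuous function is
absolutely continuous. -/
lemma absolutelyContinuousOnInterval_of_dist_le {F H : ℝ → ℝ} {s t : ℝ}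
    (hH : AbsolutelyContinuousOnInterval H s t)
    (hFH : ∀ u ∈ uIcc s t, ∀ v ∈ uIcc s t, dist (F u) (F v) ≤ dist (H u) (H v)) :
    AbsolutelyContinuousOnInterval F s t := by
  unfold AbsolutelyContinuousOnInterval at hH ⊢
  refine squeeze_zero' (Eventually.of_forall fun E => Finset.sum_nonneg fun _ _ => dist_nonneg)
    ?_ hH
  filter_upwards [mem_inf_of_right (mem_principal_self _)] with E hE
  exact Finset.sum_le_sum fun i hi => hFH _ (hE.1 i hi).1 _ (hE.1 i hi).2

/-- A pointwise minimum `F` of finitely many primitives `f i` of `g i` grows at least at rate `h`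
if at each time some `f i` attaining the minimum has `g i ≥ h`. -/
lemma add_integral_le_of_envelope {ι : Type*} [Fintype ι] {f g : ι → ℝ → ℝ} {F h : ℝ → ℝ}
    {s t : ℝ} (hst : s ≤ t) (hg : ∀ i, IntervalIntegrable (g i) volume s t)
    (hf : ∀ i, ∀ u ∈ Icc s t, f i u = f i s + ∫ τ in s..u, g i τ)
    (hF : ∀ u ∈ Icc s t, ∀ i, F u ≤ f i u)
    (hact : ∀ u ∈ Icc s t, ∃ i, F u = f i u ∧ h u ≤ g i u)
    (hh : IntervalIntegrable h volume s t) :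
    F s + ∫ τ in s..t, h τ ≤ F t := by
  have hsub : ∀ {u v}, u ∈ Icc s t → v ∈ Icc s t → uIcc u v ⊆ uIcc s t := fun hu hv => by
    rw [uIcc_of_le hst]; exact uIcc_subset_Icc hu hv
  have hG : IntervalIntegrable (fun τ => ∑ i, |g i τ|) volume s t := by
    have := IntervalIntegrable.sum (μ := volume) (a := s) (b := t) Finset.univ
      (f := fun i τ => |g i τ|) fun i _ => (hg i).abs
    simpa [Finset.sum_fn] using this
  have hfsub : ∀ i, ∀ u ∈ Icc s t, ∀ v ∈ Icc s t, f i v - f i u = ∫ τ in u..v, g i τ := by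
    intro i u hu v hv
    have hs : s ∈ Icc s t := left_mem_Icc.2 hst
    rw [hf i u hu, hf i v hv, ← intervalIntegral.integral_add_adjacent_intervals
      ((hg i).mono_set (hsub hs hu)) ((hg i).mono_set (hsub hu hv))]
    ring
  have hle : ∀ i, ∀ u ∈ Icc s t, ∀ v ∈ Icc s t, u ≤ v →
      |f i v - f i u| ≤ ∫ τ in u..v, ∑ i, |g i τ| := by
    intro i u hu v hv huv
    rw [hfsub i u hu v hv]
    refine (intervalIntegral.abs_integral_le_integral_abs huv).trans ?_
    refine intervalIntegral.integral_mono_on huv ((hg i).abs.mono_set (hsub hu hv))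
      (hG.mono_set (hsub hu hv)) fun τ _ => ?_
    exact Finset.single_le_sum (f := fun i => |g i τ|) (fun _ _ => abs_nonneg _)
      (Finset.mem_univ i)
  have hdist : ∀ u ∈ Icc s t, ∀ v ∈ Icc s t, u ≤ v →
      dist (F u) (F v) ≤ dist (∫ τ in s..u, ∑ i, |g i τ|) (∫ τ in s..v, ∑ i, |g i τ|) := by
    intro u hu v hv huv
    have hs : s ∈ Icc s t := left_mem_Icc.2 hst
    have e : (∫ τ in s..v, ∑ i, |g i τ|) - (∫ τ in s..u, ∑ i, |g i τ|)
        = ∫ τ in u..v, ∑ i, |g i τ| := by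
      rw [← intervalIntegral.integral_add_adjacent_intervals
        (hG.mono_set (hsub hs hu)) (hG.mono_set (hsub hu hv))]
      ring
    rw [dist_comm, dist_comm (∫ τ in s..u, ∑ i, |g i τ|), Real.dist_eq, Real.dist_eq, e]
    refine le_trans ?_ (le_abs_self _)
    -- An index active at `u` bounds `F v - F u` from above, one active at `v` bounds it from below.
    obtain ⟨i, hi, -⟩ := hact u hu
    obtain ⟨j, hj, -⟩ := hact v hv
    have h1 := abs_le.1 (hle i u hu v hv huv)
    have h2 := abs_le.1 (hle j u hu v hv huv)
    have h3 := hF v hv i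
    have h4 := hF u hu j
    rw [abs_le]
    constructor <;> linarith
  have hAC : AbsolutelyContinuousOnInterval F s t := by
    refine absolutelyContinuousOnInterval_of_dist_le
      (hG.absolutelyContinuousOnInterval_intervalIntegral left_mem_uIcc) ?_
    rw [uIcc_of_le hst]
    intro u hu v hv
    rcases le_total u v with huv | huv
    · exact hdist u hu v hv huv
    · rw [dist_comm, dist_comm (∫ τ in s..u, ∑ i, |g i τ|)]
      exact hdist v hv u hu huv
  have hder : ∀ᵐ u, u ∈ Ioo s t → h u ≤ deriv F u := by
    have h1 : ∀ᵐ u, ∀ i, u ∈ uIcc s t → HasDerivAt (fun v => ∫ τ in s..v, g i τ) (g i u) u := by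
      rw [ae_all_iff]
      intro i
      filter_upwards [(hg i).ae_hasDerivAt_integral] with u hu hu'
      exact hu hu' s left_mem_uIcc
    filter_upwards [hAC.ae_differentiableAt, h1] with u hu1 hu2 hu
    have hu' : u ∈ Icc s t := Ioo_subset_Icc_self hu
    have hu'' : u ∈ uIcc s t := by rwa [uIcc_of_le hst]
    obtain ⟨i, hi, hhi⟩ := hact u hu'
    have hd := ((hu1 hu'').hasDerivAt).sub (hu2 i hu'')
    -- `F - f i` is at most 0 and vanishes at `u`, so wherever both derivatives exist they agree,
    -- whichever indices are active nearby.
    have hmax : IsLocalMax (F - fun v => ∫ τ in s..v, g i τ) u := by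
      filter_upwards [Ioo_mem_nhds hu.1 hu.2] with v hv
      have hv' : v ∈ Icc s t := Ioo_subset_Icc_self hv
      have h3 := hF v hv' i
      have h4 := hf i u hu'
      have h5 := hf i v hv'
      simp only [Pi.sub_apply]
      linarith
    have := hmax.hasDerivAt_eq_zero hd
    linarith
  have hint := hAC.integral_deriv_eq_sub
  have : ∫ τ in s..t, h τ ≤ ∫ τ in s..t, deriv F τ := by
    refine intervalIntegral.integral_mono_ae_restrict hst hh hAC.intervalIntegrable_deriv ?_
    rw [EventuallyLE, ← Measure.restrict_congr_set Ioo_ae_eq_Icc,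
      ae_restrict_iff' measurableSet_Ioo]
    exact hder
  linarith

/-! ### Geometric weights against cut-balance -/

/-- The inequality of `sum_weighted_diff_ge` for the indicator of an upper set of `Fin n`. -/
lemma sum_weighted_indicator_nonneg {n : ℕ} {b : Fin n → Fin n → ℝ} {K : ℝ} (hK : 1 ≤ K)
    (hb : ∀ i j, 0 ≤ b i j)
    (hcut : ∀ S : Finset (Fin n), S.Nonempty → S ≠ Finset.univ →
      K⁻¹ * ∑ i ∈ S, ∑ j ∈ Sᶜ, b j i ≤ ∑ i ∈ S, ∑ j ∈ Sᶜ, b i j)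
    {r : ℕ} (hr : r + 1 < n) (I : Fin n → ℝ) (hI : ∀ k, I k = if r < (k : ℕ) then 1 else 0) :
    0 ≤ ∑ k, ∑ l, b k l * ((2 * K)⁻¹ ^ (k : ℕ) * (I l - I k)
      - (2 * K)⁻¹ ^ n / (2 * (1 + K)) * |I l - I k|) := by
  set q : ℝ := (2 * K)⁻¹ with hq
  set c : ℝ := q ^ n / (2 * (1 + K)) with hc
  have hK0 : 0 < K := by linarith
  have hq0 : 0 < q := by positivity
  have hq1 : q ≤ 1 := inv_le_one_of_one_le₀ (by linarith)
  have hqK : q * K = 1 / 2 := by rw [hq]; field_simp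
  have hc0 : 0 ≤ c := by positivity
  set S : Finset (Fin n) := Finset.univ.filter fun k => (k : ℕ) ≤ r with hS
  have memS : ∀ k, k ∈ S ↔ (k : ℕ) ≤ r := fun k => by simp [hS]
  have hSne : S.Nonempty := ⟨⟨0, by omega⟩, by simp [memS]⟩
  have hSu : S ≠ Finset.univ := fun h => by
    have : (⟨r + 1, hr⟩ : Fin n) ∈ S := h ▸ Finset.mem_univ _
    rw [memS] at this
    simp at this
  have IS : ∀ k ∈ S, I k = 0 := fun k hk => by
    rw [hI, if_neg]; rw [memS] at hk; omega
  have ISc : ∀ k ∈ Sᶜ, I k = 1 := fun k hk => by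
    rw [hI, if_pos]; rw [Finset.mem_compl, memS] at hk; omega
  set A := ∑ i ∈ S, ∑ j ∈ Sᶜ, b i j with hA
  set B := ∑ i ∈ S, ∑ j ∈ Sᶜ, b j i with hB
  have hA0 : 0 ≤ A := Finset.sum_nonneg fun i _ => Finset.sum_nonneg fun j _ => hb i j
  have hBA : B ≤ K * A := by
    have := hcut S hSne hSu
    rwa [inv_mul_le_iff₀ hK0] at this
  -- Rows in `S` are pulled up with weight at least `q ^ r`; in `h2`, rows in `Sᶜ` are pulled down
  -- with weight at most `q ^ (r + 1)`.
  have h1 : (q ^ r - c) * A ≤ ∑ k ∈ S, ∑ l, b k l * (q ^ (k : ℕ) * (I l - I k)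
      - c * |I l - I k|) := by
    rw [hA, Finset.mul_sum]
    refine Finset.sum_le_sum fun k hk => ?_
    rw [← Finset.sum_add_sum_compl S, Finset.sum_eq_zero (s := S), zero_add, Finset.mul_sum]
    · refine Finset.sum_le_sum fun l hl => ?_
      rw [IS k hk, ISc l hl, mul_comm]
      have : q ^ r ≤ q ^ (k : ℕ) := pow_le_pow_of_le_one hq0.le hq1 ((memS k).1 hk)
      simp only [sub_zero, mul_one, abs_one]
      exact mul_le_mul_of_nonneg_left (by linarith) (hb k l)
    · intro l hl
      rw [IS k hk, IS l hl]; simp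
  have h2 : -(q ^ (r + 1) + c) * B ≤ ∑ k ∈ Sᶜ, ∑ l, b k l * (q ^ (k : ℕ) * (I l - I k)
      - c * |I l - I k|) := by
    rw [hB, Finset.sum_comm, Finset.mul_sum]
    refine Finset.sum_le_sum fun k hk => ?_
    rw [← Finset.sum_add_sum_compl S, Finset.sum_eq_zero (s := Sᶜ), add_zero, Finset.mul_sum]
    · refine Finset.sum_le_sum fun l hl => ?_
      rw [IS l hl, ISc k hk, mul_comm]
      have hk' : r + 1 ≤ (k : ℕ) := by
        rw [Finset.mem_compl, memS] at hk; omega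
      have : q ^ (k : ℕ) ≤ q ^ (r + 1) := pow_le_pow_of_le_one hq0.le hq1 hk'
      simp only [zero_sub, abs_neg, abs_one, mul_one]
      exact mul_le_mul_of_nonneg_left (by linarith) (hb k l)
    · intro l hl
      rw [ISc k hk, ISc l hl]; simp
  rw [← Finset.sum_add_sum_compl S]
  -- Since `q * K = 1 / 2`, the downward pull costs at most half of the gain `q ^ r * A`; `c` is
  -- chosen so that the absolute values fit into the other half.
  have hcK : c * (1 + K) = q ^ n / 2 := by rw [hc]; field_simp
  have hqn : q ^ n ≤ q ^ r := pow_le_pow_of_le_one hq0.le hq1 (by omega)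
  have h3 : (q ^ (r + 1) + c) * B ≤ (q ^ (r + 1) + c) * (K * A) :=
    mul_le_mul_of_nonneg_left hBA (by positivity)
  have h4 : (q ^ r - c) * A - (q ^ (r + 1) + c) * (K * A) = (q ^ r - q ^ n) / 2 * A := by
    rw [pow_succ]
    linear_combination (-(q ^ r) * A) * hqK - A * hcK
  have h5 : 0 ≤ (q ^ r - q ^ n) / 2 * A := mul_nonneg (by linarith) hA0
  linarith

/-- A function on `Fin n` is the sum of its increments. -/
lemma exists_increments {n : ℕ} (y : Fin n → ℝ) (hy : Monotone y) :
    ∃ (y₀ : ℝ) (g : ℕ → ℝ), (∀ r, 0 ≤ g r) ∧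
      ∀ k, y k = y₀ + ∑ r ∈ Finset.range (n - 1), g r * (if r < (k : ℕ) then 1 else 0) := by
  rcases Nat.eq_zero_or_pos n with rfl | hn
  · exact ⟨0, 0, fun _ => le_rfl, fun k => k.elim0⟩
  -- Continuing `y` by its last value lets the increments telescope over `ℕ`.
  set Y : ℕ → ℝ := fun r => y ⟨min r (n - 1), by omega⟩ with hY
  refine ⟨Y 0, fun r => Y (r + 1) - Y r, fun r => ?_, fun k => ?_⟩
  · refine sub_nonneg.2 (hy ?_)
    simp only [Fin.mk_le_mk]
    omega
  · have hk : (k : ℕ) ≤ n - 1 := by omega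
    have h1 : ∑ r ∈ Finset.range (n - 1), (Y (r + 1) - Y r) * (if r < (k : ℕ) then (1 : ℝ) else 0)
        = ∑ r ∈ Finset.range k, (Y (r + 1) - Y r) := by
      rw [← Finset.sum_subset (Finset.range_mono hk)]
      · refine Finset.sum_congr rfl fun r hr => ?_
        rw [if_pos (Finset.mem_range.1 hr), mul_one]
      · intro r _ hr
        rw [if_neg (by simpa using hr), mul_zero]
    rw [h1, Finset.sum_range_sub]
    have : Y k = y k := by simp only [hY]; congr 1; ext; simp; omega
    linarith

/-- For a cut-balanced matrix `b` and a sorted vector `y`, geometric weights make the weighted sum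
of the drifts `∑ l, b k l * (y l - y k)` dominate all the interactions. -/
lemma sum_weighted_diff_ge {n : ℕ} {b : Fin n → Fin n → ℝ} {K : ℝ} (hK : 1 ≤ K)
    (hb : ∀ i j, 0 ≤ b i j)
    (hcut : ∀ S : Finset (Fin n), S.Nonempty → S ≠ Finset.univ →
      K⁻¹ * ∑ i ∈ S, ∑ j ∈ Sᶜ, b j i ≤ ∑ i ∈ S, ∑ j ∈ Sᶜ, b i j)
    {y : Fin n → ℝ} (hy : Monotone y) :
    (2 * K)⁻¹ ^ n / (2 * (1 + K)) * ∑ k, ∑ l, b k l * |y l - y k|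
      ≤ ∑ k : Fin n, (2 * K)⁻¹ ^ (k : ℕ) * ∑ l, b k l * (y l - y k) := by
  obtain ⟨y₀, g, hg, hyg⟩ := exists_increments y hy
  set c : ℝ := (2 * K)⁻¹ ^ n / (2 * (1 + K)) with hc
  have hc0 : 0 ≤ c := by positivity
  set I : ℕ → Fin n → ℝ := fun r k => if r < (k : ℕ) then 1 else 0 with hI
  have hdiff : ∀ k l, y l - y k = ∑ r ∈ Finset.range (n - 1), g r * (I r l - I r k) := by
    intro k l
    rw [hyg k, hyg l]
    simp only [mul_sub, Finset.sum_sub_distrib, hI]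
    ring
  -- The triangle inequality suffices, because the absolute values enter with the sign `-c`; the
  -- claim thus reduces to indicators of upper sets.
  have habs : ∀ k l, |y l - y k| ≤ ∑ r ∈ Finset.range (n - 1), g r * |I r l - I r k| := by
    intro k l
    rw [hdiff]
    refine (Finset.abs_sum_le_sum_abs _ _).trans (Finset.sum_le_sum fun r _ => ?_)
    rw [abs_mul, abs_of_nonneg (hg r)]
  have key : 0 ≤ ∑ r ∈ Finset.range (n - 1), g r * ∑ k, ∑ l, b k l *
      ((2 * K)⁻¹ ^ (k : ℕ) * (I r l - I r k) - c * |I r l - I r k|) := by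
    refine Finset.sum_nonneg fun r hr => mul_nonneg (hg r) ?_
    have hr' : r + 1 < n := by have := Finset.mem_range.1 hr; omega
    exact sum_weighted_indicator_nonneg hK hb hcut hr' (I r) fun k => rfl
  have key2 : ∑ r ∈ Finset.range (n - 1), g r * ∑ k, ∑ l, b k l *
      ((2 * K)⁻¹ ^ (k : ℕ) * (I r l - I r k) - c * |I r l - I r k|)
      = ∑ k, ∑ l, b k l * ((2 * K)⁻¹ ^ (k : ℕ) * (y l - y k)
        - c * ∑ r ∈ Finset.range (n - 1), g r * |I r l - I r k|) := by
    simp only [hdiff, Finset.mul_sum, ← Finset.sum_sub_distrib]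
    rw [Finset.sum_comm]
    refine Finset.sum_congr rfl fun k _ => ?_
    rw [Finset.sum_comm]
    refine Finset.sum_congr rfl fun l _ => Finset.sum_congr rfl fun r _ => ?_
    ring
  rw [key2] at key
  rw [← sub_nonneg]
  refine key.trans ?_
  rw [Finset.mul_sum, ← Finset.sum_sub_distrib]
  refine Finset.sum_le_sum fun k _ => ?_
  rw [Finset.mul_sum, Finset.mul_sum, ← Finset.sum_sub_distrib]
  refine Finset.sum_le_sum fun l _ => ?_
  have h1 := mul_le_mul_of_nonneg_left (habs k l) (mul_nonneg hc0 (hb k l))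
  linarith

/-! ### Linearity, continuity and comparison for solutions -/

/-- The right-hand side `∑ j, a i j * (x j - x i)` of the consensus system. -/
noncomputable def drift {n : ℕ} (a : Fin n → Fin n → ℝ → ℝ) (x : ℝ → Fin n → ℝ) (i : Fin n)
    (τ : ℝ) : ℝ :=
  ∑ j, a i j τ * (x τ j - x τ i)

variable {n : ℕ} {a : Fin n → Fin n → ℝ → ℝ} {x : ℝ → Fin n → ℝ}

lemma IsSolution.intervalIntegrable_drift (hx : IsSolution a x) (i : Fin n) {s t : ℝ}
    (hs : 0 ≤ s) (ht : 0 ≤ t) : IntervalIntegrable (drift a x i) volume s t :=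
  ((hx i s hs).1.symm).trans (hx i t ht).1

lemma IsSolution.eq_add_integral (hx : IsSolution a x) (i : Fin n) {s t : ℝ}
    (hs : 0 ≤ s) (ht : 0 ≤ t) : x t i = x s i + ∫ τ in s..t, drift a x i τ := by
  have h := intervalIntegral.integral_add_adjacent_intervals
    (hx.intervalIntegrable_drift i le_rfl hs) (hx.intervalIntegrable_drift i hs ht)
  have h1 : x s i = x 0 i + ∫ τ in (0 : ℝ)..s, drift a x i τ := (hx i s hs).2
  have h2 : x t i = x 0 i + ∫ τ in (0 : ℝ)..t, drift a x i τ := (hx i t ht).2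
  linarith

lemma IsSolution.affine (hx : IsSolution a x) (p q : ℝ) :
    IsSolution a fun t i => p * x t i + q := by
  intro i t ht
  have e : (fun τ => ∑ j, a i j τ * (p * x τ j + q - (p * x τ i + q)))
      = fun τ => p * ∑ j, a i j τ * (x τ j - x τ i) := by
    funext τ
    rw [Finset.mul_sum]
    exact Finset.sum_congr rfl fun j _ => by ring
  obtain ⟨h1, h2⟩ := hx i t ht
  simp only [e, intervalIntegral.integral_const_mul]
  refine ⟨h1.const_mul p, ?_⟩
  rw [h2]
  ring

lemma IsSolution.add {y : ℝ → Fin n → ℝ} (hx : IsSolution a x) (hy : IsSolution a y) :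
    IsSolution a (x + y) := by
  intro i t ht
  have e : (fun τ => ∑ j, a i j τ * ((x + y) τ j - (x + y) τ i))
      = fun τ => (∑ j, a i j τ * (x τ j - x τ i)) + ∑ j, a i j τ * (y τ j - y τ i) := by
    funext τ
    rw [← Finset.sum_add_distrib]
    exact Finset.sum_congr rfl fun j _ => by simp only [Pi.add_apply]; ring
  obtain ⟨h1, h2⟩ := hx i t ht
  obtain ⟨h3, h4⟩ := hy i t ht
  rw [e, intervalIntegral.integral_add h1 h3]
  refine ⟨h1.add h3, ?_⟩
  simp only [Pi.add_apply]
  rw [h2, h4]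
  ring

lemma IsSolution.continuousOn (hx : IsSolution a x) (i : Fin n) :
    ContinuousOn (fun t => x t i) (Ici 0) := by
  intro t ht
  have ht0 : (0 : ℝ) ≤ t := ht
  have h1 : ContinuousOn (fun u => x 0 i + ∫ τ in (0 : ℝ)..u, drift a x i τ) (uIcc 0 (t + 1)) :=
    continuousOn_const.add (intervalIntegral.continuousOn_primitive_interval
      ((intervalIntegrable_iff_integrableOn_Icc_of_le (by linarith)).1
        (hx.intervalIntegrable_drift i le_rfl (by linarith : 0 ≤ t + 1)) |>.mono_set
          (by rw [uIcc_of_le (by linarith)])))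
  rw [uIcc_of_le (by linarith)] at h1
  have h2 : ContinuousOn (fun u => x u i) (Icc 0 (t + 1)) :=
    h1.congr fun u hu => (hx i u hu.1).2
  -- The extra unit of time makes `Icc 0 (t + 1)` a neighbourhood of `t` within `Ici 0`.
  refine (h2 t ⟨ht0, by linarith⟩).mono_of_mem_nhdsWithin ?_
  rw [← Ici_inter_Iic]
  exact inter_mem_nhdsWithin _ (Iic_mem_nhds (by linarith))

/-- A lower bound for the components in `C` when, at a component minimal in `C`, the drift is
at least `h`. -/
lemma IsSolution.add_integral_le (hx : IsSolution a x) {s t : ℝ} (hs : 0 ≤ s) (hst : s ≤ t)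
    (C : Finset (Fin n)) {h : ℝ → ℝ} (hh : IntervalIntegrable h volume s t) {m : ℝ}
    (hm : ∀ k ∈ C, m ≤ x s k)
    (hC : ∀ u ∈ Icc s t, ∀ k ∈ C, (∀ l ∈ C, x u k ≤ x u l) → h u ≤ drift a x k u) :
    ∀ k ∈ C, m + ∫ τ in s..t, h τ ≤ x t k := by
  intro k hk
  have hne : C.Nonempty := ⟨k, hk⟩
  have key := add_integral_le_of_envelope (ι := C) (f := fun k u => x u k)
    (g := fun k => drift a x k) (F := fun u => C.inf' hne (x u)) (h := h) hst
    (fun k => hx.intervalIntegrable_drift k hs (hs.trans hst))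
    (fun k u hu => hx.eq_add_integral k hs (hs.trans hu.1))
    (fun u _ k => Finset.inf'_le _ k.2)
    (fun u hu => by
      obtain ⟨l, hl, hle⟩ := C.exists_mem_eq_inf' hne (x u)
      exact ⟨⟨l, hl⟩, hle, hC u hu l hl fun j hj => hle ▸ Finset.inf'_le _ hj⟩) hh
  have h1 : m ≤ C.inf' hne (x s) := Finset.le_inf' _ _ hm
  have h2 : C.inf' hne (x t) ≤ x t k := Finset.inf'_le _ hk
  linarith

/-- At a globally minimal component all terms of the drift are nonnegative, so the minimum cannot
decrease. -/
lemma IsSolution.ge_of_ge (ha : IsCoefficients a) (hx : IsSolution a x) {s t : ℝ} (hs : 0 ≤ s)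
    (hst : s ≤ t) {m : ℝ} (hm : ∀ k, m ≤ x s k) (k : Fin n) : m ≤ x t k := by
  have := hx.add_integral_le hs hst Finset.univ (h := fun _ => 0) intervalIntegrable_const
    (fun k _ => hm k)
    (fun u hu k _ hk => Finset.sum_nonneg fun j _ => mul_nonneg
      (ha.nonneg k j u (hs.trans hu.1)) (sub_nonneg.2 (hk j (Finset.mem_univ j))))
    k (Finset.mem_univ k)
  simpa using this

lemma IsSolution.le_of_le (ha : IsCoefficients a) (hx : IsSolution a x) {s t : ℝ} (hs : 0 ≤ s)
    (hst : s ≤ t) {m : ℝ} (hm : ∀ k, x s k ≤ m) (k : Fin n) : x t k ≤ m := by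
  have := (hx.affine (-1) 0).ge_of_ge ha hs hst (m := -m) (fun k => by linarith [hm k]) k
  linarith

/-! ### Integrability of the interactions and convergence -/

/-- `sum_weighted_diff_ge` for a vector that is not sorted, in terms of its sorting permutation. -/
lemma sum_weighted_diff_sort_ge {b : Fin n → Fin n → ℝ} {K : ℝ} (hK : 1 ≤ K)
    (hb : ∀ i j, 0 ≤ b i j)
    (hcut : ∀ S : Finset (Fin n), S.Nonempty → S ≠ Finset.univ →
      K⁻¹ * ∑ i ∈ S, ∑ j ∈ Sᶜ, b j i ≤ ∑ i ∈ S, ∑ j ∈ Sᶜ, b i j)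
    (y : Fin n → ℝ) :
    (2 * K)⁻¹ ^ n / (2 * (1 + K)) * ∑ i, ∑ j, b i j * |y j - y i|
      ≤ ∑ k : Fin n, (2 * K)⁻¹ ^ (k : ℕ) *
        ∑ j, b (Tuple.sort y k) j * (y j - y (Tuple.sort y k)) := by
  set σ := Tuple.sort y with hσ
  have h := sum_weighted_diff_ge (b := fun k l => b (σ k) (σ l)) hK (fun i j => hb _ _)
    (fun S hS hSu => by
      -- A cut `S` of the relabelled matrix is the cut `σ(S)` of `b`.
      have := hcut (S.map σ.toEmbedding) (hS.map) (fun h => hSu ?_)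
      · have hc : (S.map σ.toEmbedding)ᶜ = Sᶜ.map σ.toEmbedding := by
          ext k; simp [Finset.mem_map_equiv]
        simpa [hc, Finset.sum_map] using this
      · ext k
        have : σ k ∈ S.map σ.toEmbedding := h ▸ Finset.mem_univ _
        simpa using this) (Tuple.monotone_sort y)
  have e1 : ∑ k, ∑ l, b (σ k) (σ l) * |(y ∘ σ) l - (y ∘ σ) k| = ∑ i, ∑ j, b i j * |y j - y i| := by
    rw [← Equiv.sum_comp σ fun i => ∑ j, b i j * |y j - y i|]
    exact Finset.sum_congr rfl fun k _ =>
      Equiv.sum_comp σ fun j => b (σ k) j * |y j - y (σ k)|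
  have e2 : ∀ k, ∑ l, b (σ k) (σ l) * ((y ∘ σ) l - (y ∘ σ) k)
      = ∑ j, b (σ k) j * (y j - y (σ k)) := fun k =>
    Equiv.sum_comp σ fun j => b (σ k) j * (y j - y (σ k))
  exact (congrArg _ e1.symm).le.trans (h.trans
    (Finset.sum_congr rfl fun k _ => congrArg _ (e2 k)).le)

/-- Sorting minimizes a weighted sum with decreasing weights. -/
lemma sum_weighted_sort_le {w : Fin n → ℝ} (hw : Antitone w) (y : Fin n → ℝ)
    (σ : Equiv.Perm (Fin n)) : ∑ k, w k * y (Tuple.sort y k) ≤ ∑ k, w k * y (σ k) := by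
  have h : Antivary w (y ∘ Tuple.sort y) := hw.antivary (Tuple.monotone_sort y)
  have := h.sum_mul_le_sum_mul_comp_perm (σ := σ.trans (Tuple.sort y).symm)
  simpa using this

lemma IsSolution.aemeasurable_interaction (ha : IsCoefficients a) (hx : IsSolution a x)
    (i j : Fin n) :
    AEMeasurable (fun t => a i j t * |x t j - x t i|) (volume.restrict (Ici 0)) :=
  (ha.aemeasurable i j).mul
    (((hx.continuousOn j).sub (hx.continuousOn i)).abs.aemeasurable measurableSet_Ici)

/-- All interactions are integrable over `[0, ∞)`. -/
lemma IsSolution.integrableOn_interaction (ha : IsCoefficients a) (hcb : CutBalanced a)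
    (hx : IsSolution a x) (i j : Fin n) :
    IntegrableOn (fun t => a i j t * |x t j - x t i|) (Ici 0) := by
  obtain ⟨K, hK, hcut⟩ := hcb
  have hK0 : 0 < K := by linarith
  set q : ℝ := (2 * K)⁻¹ with hq
  set c : ℝ := q ^ n / (2 * (1 + K)) with hc
  have hq0 : 0 < q := by positivity
  have hq1 : q ≤ 1 := inv_le_one_of_one_le₀ (by linarith)
  have hc0 : 0 < c := by positivity
  set w : Fin n → ℝ := fun k => q ^ (k : ℕ) with hw
  have hwanti : Antitone w := fun k l hkl => pow_le_pow_of_le_one hq0.le hq1 hkl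
  set h : ℝ → ℝ := fun t => c * ∑ i, ∑ j, a i j t * |x t j - x t i| with hh
  have hterm0 : ∀ t, 0 ≤ t → ∀ i j, 0 ≤ a i j t * |x t j - x t i| := fun t ht i j =>
    mul_nonneg (ha.nonneg i j t ht) (abs_nonneg _)
  have hh0 : ∀ t, 0 ≤ t → 0 ≤ h t := fun t ht =>
    mul_nonneg hc0.le (Finset.sum_nonneg fun i _ => Finset.sum_nonneg fun j _ => hterm0 t ht i j)
  have hhm : AEMeasurable h (volume.restrict (Ici 0)) := by
    refine AEMeasurable.const_mul ?_ c
    refine Finset.aemeasurable_fun_sum _ fun i _ => Finset.aemeasurable_fun_sum _ fun j _ => ?_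
    exact hx.aemeasurable_interaction ha i j
  set g : Equiv.Perm (Fin n) → ℝ → ℝ := fun σ t => ∑ k, w k * drift a x (σ k) t with hg
  have hgi : ∀ σ, ∀ t, 0 ≤ t → IntervalIntegrable (g σ) volume 0 t := fun σ t ht => by
    have := IntervalIntegrable.sum (μ := volume) (a := 0) (b := t) Finset.univ
      (f := fun k τ => w k * drift a x (σ k) τ)
      fun k _ => (hx.intervalIntegrable_drift (σ k) le_rfl ht).const_mul (w k)
    simpa [Finset.sum_fn] using this
  have hhg : ∀ t, 0 ≤ t → h t ≤ g (Tuple.sort (x t)) t := fun t ht =>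
    sum_weighted_diff_sort_ge hK (fun i j => ha.nonneg i j t ht)
      (fun S hS hSu => (hcut t ht S hS hSu).1) (x t)
  -- The coefficients need not be locally integrable; local integrability of `h` comes from `0 ≤ h ≤
  -- ∑ σ, |g σ|`.
  have hhi : ∀ t, 0 ≤ t → IntervalIntegrable h volume 0 t := by
    intro t ht
    have hG : IntervalIntegrable (fun τ => ∑ σ, |g σ τ|) volume 0 t := by
      have := IntervalIntegrable.sum (μ := volume) (a := 0) (b := t) Finset.univ
        (f := fun σ τ => |g σ τ|) fun σ _ => (hgi σ t ht).abs
      simpa [Finset.sum_fn] using this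
    rw [intervalIntegrable_iff_integrableOn_Icc_of_le ht] at hG ⊢
    refine Integrable.mono' hG
      (hhm.mono_measure (Measure.restrict_mono Icc_subset_Ici_self le_rfl)).aestronglyMeasurable ?_
    filter_upwards [ae_restrict_mem measurableSet_Icc] with τ hτ
    rw [Real.norm_of_nonneg (hh0 τ hτ.1)]
    refine (hhg τ hτ.1).trans ((le_abs_self _).trans ?_)
    exact Finset.single_le_sum (f := fun σ => |g σ τ|) (fun _ _ => abs_nonneg _)
      (Finset.mem_univ _)
  have hbound : ∀ t, 0 ≤ t → ∫ τ in (0 : ℝ)..t, h τ ≤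
      (∑ k, w k * ⨆ j, x 0 j) - ∑ k, w k * x 0 (Tuple.sort (x 0) k) := by
    intro t ht
    -- The envelope is over permutations; the sorting permutation at time `u` is active there and
    -- has rate at least `h u`.
    have key := add_integral_le_of_envelope (ι := Equiv.Perm (Fin n))
      (f := fun σ u => ∑ k, w k * x u (σ k)) (g := g)
      (F := fun u => ∑ k, w k * x u (Tuple.sort (x u) k)) (h := h) ht
      (fun σ => hgi σ t ht)
      (fun σ u hu => by
        simp only [hg]
        rw [intervalIntegral.integral_finsetSum fun k _ =>
          (hx.intervalIntegrable_drift (σ k) le_rfl hu.1).const_mul (w k),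
          ← Finset.sum_add_distrib]
        refine Finset.sum_congr rfl fun k _ => ?_
        rw [hx.eq_add_integral (σ k) le_rfl hu.1, intervalIntegral.integral_const_mul, mul_add])
      (fun u _ σ => sum_weighted_sort_le hwanti (x u) σ)
      (fun u hu => ⟨Tuple.sort (x u), rfl, hhg u hu.1⟩) (hhi t ht)
    have h1 : ∑ k, w k * x t (Tuple.sort (x t) k) ≤ ∑ k, w k * ⨆ j, x 0 j :=
      Finset.sum_le_sum fun k _ => mul_le_mul_of_nonneg_left
        (hx.le_of_le ha le_rfl ht (fun j => le_ciSup (finite_range _).bddAbove j) _)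
        (pow_nonneg hq0.le _)
    linarith
  have hInt : IntegrableOn h (Ioi 0) := by
    refine integrableOn_Ioi_of_intervalIntegral_norm_bounded
      ((∑ k, w k * ⨆ j, x 0 j) - ∑ k, w k * x 0 (Tuple.sort (x 0) k)) 0
      (fun t => ?_) tendsto_id ((eventually_ge_atTop 0).mono fun t ht => ?_)
    -- The `max` covers negative `t`, for which the interval is empty.
    · exact (hhi (max t 0) (le_max_right _ _)).1.mono_set
        (Ioc_subset_Ioc_right (le_max_left _ _))
    · refine le_trans (le_of_eq ?_) (hbound t ht)
      refine intervalIntegral.integral_congr fun τ hτ => ?_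
      rw [id, uIcc_of_le ht] at hτ
      exact Real.norm_of_nonneg (hh0 τ hτ.1)
  rw [← integrableOn_Ici_iff_integrableOn_Ioi] at hInt
  refine Integrable.mono' (hInt.const_mul c⁻¹)
    (hx.aemeasurable_interaction ha i j).aestronglyMeasurable ?_
  filter_upwards [ae_restrict_mem measurableSet_Ici] with t ht
  rw [Real.norm_of_nonneg (hterm0 t ht i j), hh, inv_mul_cancel_left₀ hc0.ne']
  refine le_trans ?_ (Finset.single_le_sum (f := fun i => ∑ j, a i j t * |x t j - x t i|)
    (fun i _ => Finset.sum_nonneg fun j _ => hterm0 t ht i j) (Finset.mem_univ i))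
  exact Finset.single_le_sum (f := fun j => a i j t * |x t j - x t i|)
    (fun j _ => hterm0 t ht i j) (Finset.mem_univ j)

/-- The drift is dominated by the interactions, so its integral converges. -/
lemma IsSolution.exists_tendsto (ha : IsCoefficients a) (hcb : CutBalanced a)
    (hx : IsSolution a x) (i : Fin n) : ∃ l, Tendsto (fun t => x t i) atTop (𝓝 l) := by
  have hD : IntegrableOn (drift a x i) (Ioi 0) := by
    rw [← integrableOn_Ici_iff_integrableOn_Ioi]
    refine integrable_finsetSum _ fun j _ => ?_
    refine Integrable.mono (hx.integrableOn_interaction ha hcb i j) ?_ (Eventually.of_forall fun t => ?_)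
    · exact ((ha.aemeasurable i j).mul (((hx.continuousOn j).sub
        (hx.continuousOn i)).aemeasurable measurableSet_Ici)).aestronglyMeasurable
    · simp
  refine ⟨x 0 i + ∫ τ in Ioi 0, drift a x i τ, ?_⟩
  refine ((intervalIntegral_tendsto_integral_Ioi 0 hD tendsto_id).const_add (x 0 i)).congr' ?_
  filter_upwards [eventually_ge_atTop 0] with t ht
  exact (hx.eq_add_integral i le_rfl ht).symm

lemma IsSolution.exists_tendsto_mem_Icc (ha : IsCoefficients a) (hcb : CutBalanced a)
    (hx : IsSolution a x) (i : Fin n) :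
    ∃ l ∈ Icc (⨅ j, x 0 j) (⨆ j, x 0 j), Tendsto (fun t => x t i) atTop (𝓝 l) := by
  obtain ⟨l, hl⟩ := hx.exists_tendsto ha hcb i
  refine ⟨l, ⟨ge_of_tendsto hl ?_, le_of_tendsto hl ?_⟩, hl⟩
  · filter_upwards [eventually_ge_atTop 0] with t ht
    exact hx.ge_of_ge ha le_rfl ht (fun j => ciInf_le (finite_range _).bddBelow j) i
  · filter_upwards [eventually_ge_atTop 0] with t ht
    exact hx.le_of_le ha le_rfl ht (fun j => le_ciSup (finite_range _).bddAbove j) i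

/-! ### Strong connectivity of the weak components -/

/-- If no edge of the unbounded interactions graph leaves `S`, then none enters `S`. -/
lemma CutBalanced.not_adj_of_forall_not_adj (ha : IsCoefficients a) (hcb : CutBalanced a)
    {S : Finset (Fin n)} (hS : ∀ i ∈ S, ∀ j ∉ S, ¬ (unboundedGraph a).Adj i j)
    {u v : Fin n} (hu : u ∉ S) (hv : v ∈ S) : ¬ (unboundedGraph a).Adj u v := by
  obtain ⟨K, hK, hcut⟩ := hcb
  have hSu : S ≠ Finset.univ := fun h => hu (h ▸ Finset.mem_univ u)
  have hle : ∀ t, 0 ≤ t → a v u t ≤ K * ∑ i ∈ S, ∑ j ∈ Sᶜ, a j i t := by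
    intro t ht
    refine le_trans ?_ (hcut t ht S ⟨v, hv⟩ hSu).2
    refine le_trans ?_ (Finset.single_le_sum (f := fun i => ∑ j ∈ Sᶜ, a i j t)
      (fun i _ => Finset.sum_nonneg fun j _ => ha.nonneg i j t ht) hv)
    exact Finset.single_le_sum (f := fun j => a v j t)
      (fun j _ => ha.nonneg v j t ht) (Finset.mem_compl.2 hu)
  have hint : ∀ i ∈ S, ∀ j ∈ Sᶜ, IntegrableOn (a j i) (Ici 0) := fun i hi j hj => by
    refine ⟨(ha.aemeasurable j i).aestronglyMeasurable, ?_⟩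
    rw [hasFiniteIntegral_iff_ofReal]
    · exact lt_top_iff_ne_top.2 (hS i hi j (Finset.mem_compl.1 hj))
    · filter_upwards [ae_restrict_mem measurableSet_Ici] with t ht using ha.nonneg j i t ht
  have hsum : IntegrableOn (fun t => K * ∑ i ∈ S, ∑ j ∈ Sᶜ, a j i t) (Ici 0) :=
    (integrable_finsetSum _ fun i hi => integrable_finsetSum _ fun j hj =>
      hint i hi j hj).const_mul K
  refine ne_of_lt (lt_of_le_of_lt (lintegral_mono_ae ?_) hsum.lintegral_lt_top)
  filter_upwards [ae_restrict_mem measurableSet_Ici] with t ht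
  exact ENNReal.ofReal_le_ofReal (hle t ht)

/-- No edge leaves the set of vertices reachable from `v`, so none enters it; the edge from `u`
forces `u` into it. -/
lemma CutBalanced.reflTransGen_symm (ha : IsCoefficients a) (hcb : CutBalanced a) {u v : Fin n}
    (h : (unboundedGraph a).Adj u v) : Relation.ReflTransGen (unboundedGraph a).Adj v u := by
  classical
  by_contra hvu
  refine hcb.not_adj_of_forall_not_adj ha
    (S := Finset.univ.filter fun w => Relation.ReflTransGen (unboundedGraph a).Adj v w)
    (fun i hi j hj hij => hj ?_) (by simpa using hvu) (by simp [Relation.ReflTransGen.refl]) h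
  simp only [Finset.mem_filter, Finset.mem_univ, true_and] at hi ⊢
  exact hi.tail hij

lemma weakComponent_eq_of_adj {V : Type*} {G : Digraph V} {u v : V} (h : G.Adj u v) :
    weakComponent G u = weakComponent G v := by
  by_cases huv : u = v
  · rw [huv]
  · refine SimpleGraph.ConnectedComponent.sound (SimpleGraph.Adj.reachable ?_)
    exact ⟨huv, Or.inl h⟩

lemma CutBalanced.reflTransGen_of_weakComponent_eq (ha : IsCoefficients a) (hcb : CutBalanced a)
    {u v : Fin n} (h : weakComponent (unboundedGraph a) u = weakComponent (unboundedGraph a) v) :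
    Relation.ReflTransGen (unboundedGraph a).Adj u v := by
  have hr := SimpleGraph.ConnectedComponent.exact h
  rw [SimpleGraph.reachable_iff_reflTransGen] at hr
  induction hr with
  | refl => exact .refl
  | tail hab hbc ih =>
    have ih' := ih (SimpleGraph.ConnectedComponent.sound
      ((SimpleGraph.reachable_iff_reflTransGen _ _).2 hab))
    rcases hbc.2 with h1 | h1
    · exact ih'.tail h1
    · exact ih'.trans (hcb.reflTransGen_symm ha h1)

lemma CutBalanced.stronglyConnectedOn_supp (ha : IsCoefficients a) (hcb : CutBalanced a)
    (C : WeakComponent (unboundedGraph a)) :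
    StronglyConnectedOn (unboundedGraph a) C.supp := by
  rintro ⟨u, hu⟩ ⟨v, hv⟩
  have huv := hcb.reflTransGen_of_weakComponent_eq ha
    ((hu : weakComponent (unboundedGraph a) u = C).trans hv.symm)
  have aux : ∀ w, Relation.ReflTransGen (unboundedGraph a).Adj u w → ∀ hw : w ∈ C.supp,
      Relation.ReflTransGen (fun p q : C.supp => (unboundedGraph a).Adj p q) ⟨u, hu⟩ ⟨w, hw⟩ := by
    intro w h
    induction h with
    | refl => exact fun _ => .refl
    | tail _ hbc ih =>
      intro hw
      exact (ih ((weakComponent_eq_of_adj hbc).trans hw)).tail hbc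
  exact aux v huv hv

/-! ### Equal limits within a component -/

lemma LocallyBounded.intervalIntegrable (ha : IsCoefficients a) (hlb : LocallyBounded a)
    (i j : Fin n) {s t : ℝ} (hs : 0 ≤ s) (ht : 0 ≤ t) :
    IntervalIntegrable (a i j) volume s t := by
  have h0 : ∀ T, 0 ≤ T → IntervalIntegrable (a i j) volume 0 T := fun T hT => by
    rw [intervalIntegrable_iff_integrableOn_Icc_of_le hT]
    refine ⟨((ha.aemeasurable i j).mono_measure
      (Measure.restrict_mono Icc_subset_Ici_self le_rfl)).aestronglyMeasurable, ?_⟩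
    rw [hasFiniteIntegral_iff_ofReal]
    · exact hlb i j T
    · filter_upwards [ae_restrict_mem measurableSet_Icc] with t ht using ha.nonneg i j t ht.1
  exact (h0 s hs).symm.trans (h0 t ht)

/-- If the limits differed, `a i j` would eventually be at most a constant times its integrable
interaction; local boundedness covers the initial interval, contradicting the divergence on the
edge. -/
lemma IsSolution.limit_eq_of_adj (ha : IsCoefficients a) (hcb : CutBalanced a)
    (hlb : LocallyBounded a) (hx : IsSolution a x) {i j : Fin n}
    (hij : (unboundedGraph a).Adj j i) {li lj : ℝ} (hi : Tendsto (fun t => x t i) atTop (𝓝 li))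
    (hj : Tendsto (fun t => x t j) atTop (𝓝 lj)) : li = lj := by
  by_contra hne
  have hd : 0 < |lj - li| := abs_pos.2 (sub_ne_zero.2 (Ne.symm hne))
  have hev := ((hj.sub hi).abs).eventually (lt_mem_nhds (half_lt_self hd))
  obtain ⟨T, hT⟩ := eventually_atTop.1 (hev.and (eventually_ge_atTop 0))
  have hT0 : 0 ≤ T := (hT T le_rfl).2
  have h1 : IntegrableOn (a i j) (Icc 0 T) :=
    (intervalIntegrable_iff_integrableOn_Icc_of_le hT0).1 (hlb.intervalIntegrable ha i j le_rfl hT0)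
  have h2 : IntegrableOn (a i j) (Ici T) := by
    refine Integrable.mono' (((hx.integrableOn_interaction ha hcb i j).mono_set
      (Ici_subset_Ici.2 hT0)).const_mul (|lj - li| / 2)⁻¹) ((ha.aemeasurable i j).mono_measure
        (Measure.restrict_mono (Ici_subset_Ici.2 hT0) le_rfl)).aestronglyMeasurable ?_
    filter_upwards [ae_restrict_mem measurableSet_Ici] with t ht
    have h0 := ha.nonneg i j t (hT0.trans ht)
    rw [Real.norm_of_nonneg h0, le_inv_mul_iff₀ (by positivity), mul_comm]
    exact mul_le_mul_of_nonneg_left (hT t ht).1.le h0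
  have h3 := h1.union h2
  rw [Icc_union_Ici_eq_Ici hT0] at h3
  exact (Integrable.lintegral_lt_top h3).ne hij

lemma IsSolution.limit_eq_of_weakComponent_eq (ha : IsCoefficients a) (hcb : CutBalanced a)
    (hlb : LocallyBounded a) (hx : IsSolution a x) {i j : Fin n}
    (hij : weakComponent (unboundedGraph a) i = weakComponent (unboundedGraph a) j)
    {li lj : ℝ} (hi : Tendsto (fun t => x t i) atTop (𝓝 li))
    (hj : Tendsto (fun t => x t j) atTop (𝓝 lj)) : li = lj := by
  have h := hcb.reflTransGen_of_weakComponent_eq ha hij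
  clear hij
  induction h generalizing lj with
  | refl => exact tendsto_nhds_unique hi hj
  | tail hab hbc ih =>
    obtain ⟨l, hl⟩ := hx.exists_tendsto ha hcb _
    exact (ih hl).trans (hx.limit_eq_of_adj ha hcb hlb hbc hj hl).symm

/-! ### Backward uniqueness -/

lemma LocallyBounded.intervalIntegrable_sum (ha : IsCoefficients a) (hlb : LocallyBounded a)
    {s t : ℝ} (hs : 0 ≤ s) (ht : 0 ≤ t) :
    IntervalIntegrable (fun τ => ∑ i, ∑ j, a i j τ) volume s t := by
  rw [intervalIntegrable_iff]
  exact integrable_finsetSum _ fun i _ => integrable_finsetSum _ fun j _ =>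
    intervalIntegrable_iff.1 (hlb.intervalIntegrable ha i j hs ht)

/-- A solution that vanishes at `t` vanishes at `s < t` if the interactions in between are small. -/
lemma IsSolution.eq_zero_of_integral_le (ha : IsCoefficients a) (hlb : LocallyBounded a)
    (hx : IsSolution a x) {s t : ℝ} (hs : 0 ≤ s) (hst : s ≤ t)
    (hsmall : ∫ τ in s..t, ∑ i, ∑ j, a i j τ ≤ 1 / 4) (ht : x t = 0) : x s = 0 := by
  set R := ‖x s‖ with hR
  have hR0 : 0 ≤ R := norm_nonneg _
  have hRk : ∀ k, |x s k| ≤ R := fun k => norm_le_pi_norm (x s) k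
  have hub : ∀ u ∈ Icc s t, ∀ k, |x u k| ≤ R := fun u hu k => abs_le.2
    ⟨hx.ge_of_ge ha hs hu.1 (fun k => (abs_le.1 (hRk k)).1) k,
      hx.le_of_le ha hs hu.1 (fun k => (abs_le.1 (hRk k)).2) k⟩
  have hle : ∀ i, |x s i| ≤ R / 2 := by
    intro i
    have h1 := hx.eq_add_integral i hs (hs.trans hst)
    have h2 : x s i = -∫ τ in s..t, drift a x i τ := by
      rw [ht, Pi.zero_apply] at h1; linarith
    rw [h2, abs_neg]
    -- Differences stay within `2 * R`, so total interaction `1 / 4` gives `|x s i| ≤ R / 2` and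
    -- hence `R ≤ R / 2`.
    have h3 : |∫ τ in s..t, drift a x i τ| ≤ ∫ τ in s..t, (∑ i, ∑ j, a i j τ) * (2 * R) := by
      refine (intervalIntegral.abs_integral_le_integral_abs hst).trans ?_
      refine intervalIntegral.integral_mono_on hst
        (hx.intervalIntegrable_drift i hs (hs.trans hst)).abs
        ((hlb.intervalIntegrable_sum ha hs (hs.trans hst)).mul_const _) fun τ hτ => ?_
      have hτ0 := hs.trans hτ.1
      refine (Finset.abs_sum_le_sum_abs _ _).trans ?_
      refine le_trans ?_ (mul_le_mul_of_nonneg_right (Finset.single_le_sum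
        (f := fun i => ∑ j, a i j τ) (fun i _ => Finset.sum_nonneg fun j _ => ha.nonneg i j τ hτ0)
        (Finset.mem_univ i)) (by positivity))
      rw [Finset.sum_mul]
      refine Finset.sum_le_sum fun j _ => ?_
      rw [abs_mul, abs_of_nonneg (ha.nonneg i j τ hτ0)]
      refine mul_le_mul_of_nonneg_left ?_ (ha.nonneg i j τ hτ0)
      have := abs_sub (x τ j) (x τ i)
      linarith [hub τ hτ i, hub τ hτ j]
    rw [intervalIntegral.integral_mul_const] at h3
    nlinarith
  have : R ≤ R / 2 := (pi_norm_le_iff_of_nonneg (by positivity)).2 hle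
  exact norm_eq_zero.1 (by linarith : ‖x s‖ = 0)

/-- Backward uniqueness. -/
lemma IsSolution.initial_eq_zero (ha : IsCoefficients a) (hlb : LocallyBounded a)
    (hx : IsSolution a x) {T : ℝ} (hT : 0 ≤ T) (hxT : x T = 0) : x 0 = 0 := by
  set Z : Set ℝ := {s ∈ Icc 0 T | x s = 0} with hZ
  have hcont : ContinuousOn x (Icc 0 T) :=
    continuousOn_pi.2 fun i => (hx.continuousOn i).mono Icc_subset_Ici_self
  have hZc : IsCompact Z := isCompact_Icc.of_isClosed_subset
    (hcont.preimage_isClosed_of_isClosed isClosed_Icc isClosed_singleton) fun s hs => hs.1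
  obtain ⟨s, ⟨hsT, hs0⟩, hmin⟩ := hZc.exists_isLeast ⟨T, ⟨hT, le_rfl⟩, hxT⟩
  rcases hsT.1.eq_or_lt with h | hpos
  · rw [h]; exact hs0
  exfalso
  have hA := hlb.intervalIntegrable_sum ha le_rfl hsT.1
  have hP : ContinuousOn (fun u => ∫ τ in (0 : ℝ)..u, ∑ i, ∑ j, a i j τ) (Icc 0 s) := by
    have := intervalIntegral.continuousOn_primitive_interval (μ := volume) (a := 0) (b := s)
      (f := fun τ => ∑ i, ∑ j, a i j τ) (by
        rw [uIcc_of_le hsT.1]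
        exact (intervalIntegrable_iff_integrableOn_Icc_of_le hsT.1).1 hA)
    rwa [uIcc_of_le hsT.1] at this
  -- If the least zero time `s` were positive, some earlier `u` would have total interaction below
  -- `1 / 4` on `[u, s]`, hence be a zero as well.
  have hev : ∀ᶠ u in 𝓝[<] s, (∫ τ in (0 : ℝ)..s, ∑ i, ∑ j, a i j τ) - 1 / 4 <
      ∫ τ in (0 : ℝ)..u, ∑ i, ∑ j, a i j τ := by
    have h1 := (hP s ⟨hsT.1, le_rfl⟩).eventually (lt_mem_nhds (sub_lt_self _ (by norm_num :
      (0 : ℝ) < 1 / 4)))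
    exact h1.filter_mono (nhdsWithin_le_of_mem (Icc_mem_nhdsLT hpos))
  obtain ⟨u, hu, hus⟩ := (hev.and (Ioo_mem_nhdsLT hpos)).exists
  have hadd := intervalIntegral.integral_add_adjacent_intervals
    (hlb.intervalIntegrable_sum ha le_rfl hus.1.le)
    (hlb.intervalIntegrable_sum ha hus.1.le hsT.1)
  have hu0 := hx.eq_zero_of_integral_le ha hlb hus.1.le hus.2.le (by linarith) hs0
  exact absurd (hmin ⟨⟨hus.1.le, hus.2.le.trans hsT.2⟩, hu0⟩) (not_le.2 hus.2)

/-! ### Separation of different components -/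

/-- A group of agents starting at the maximal value `1` is pulled down only by the others. -/
lemma IsSolution.one_sub_integral_le (ha : IsCoefficients a) (hx : IsSolution a x) {T t : ℝ}
    (hT : 0 ≤ T) (hTt : T ≤ t) (C : Finset (Fin n)) {φ : ℝ → ℝ}
    (hφi : IntervalIntegrable φ volume T t)
    (hφ : ∀ u ∈ Icc T t, ∀ k ∈ C, ∑ l ∈ Cᶜ, a k l u ≤ φ u)
    (h0 : ∀ k, 0 ≤ x T k) (h1 : ∀ k, x T k ≤ 1) (hC : ∀ k ∈ C, x T k = 1) :
    ∀ k ∈ C, 1 - ∫ τ in T..t, φ τ ≤ x t k := by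
  intro k hk
  have := hx.add_integral_le hT hTt C (h := fun u => -φ u) hφi.neg (m := 1)
    (fun k hk => (hC k hk).ge)
    (fun u hu k hk hmin => by
      refine (neg_le_neg (hφ u hu k hk)).trans ?_
      have hu0 := hT.trans hu.1
      unfold drift
      rw [← Finset.sum_add_sum_compl C, ← Finset.sum_neg_distrib]
      -- Inside `C` the minimal component is only pulled up; each outside term is at least `-a k l
      -- u`, as all values stay in `[0, 1]`.
      refine le_add_of_nonneg_of_le (Finset.sum_nonneg fun l hl =>
        mul_nonneg (ha.nonneg k l u hu0) (sub_nonneg.2 (hmin l hl))) ?_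
      refine Finset.sum_le_sum fun l _ => ?_
      have h3 := hx.ge_of_ge ha hT hu.1 h0 l
      have h4 := hx.le_of_le ha hT hu.1 h1 k
      nlinarith [ha.nonneg k l u hu0]) k hk
  rw [intervalIntegral.integral_neg] at this
  linarith

/-- The solutions whose components `i` and `j` have the same limit. -/
def equalLimitSolutions (a : Fin n → Fin n → ℝ → ℝ) (i j : Fin n) :
    Submodule ℝ (ℝ → Fin n → ℝ) where
  carrier := {x | IsSolution a x ∧ Tendsto (fun t => x t i - x t j) atTop (𝓝 0)}
  zero_mem' := ⟨fun i t _ => by simp, by simp⟩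
  add_mem' := fun {x y} hx hy => ⟨hx.1.add hy.1, by
    have := hx.2.add hy.2
    simp only [add_zero] at this
    exact this.congr fun t => by simp only [Pi.add_apply]; ring⟩
  smul_mem' := fun c x hx => ⟨by
    have := hx.1.affine c 0
    simp only [add_zero] at this
    exact this, by
    have := hx.2.const_mul c
    simp only [mul_zero] at this
    exact this.congr fun t => by simp only [Pi.smul_apply, smul_eq_mul]; ring⟩

/-- The value at time `T` of the solutions whose components `i` and `j` have the same limit. -/
def equalLimitEval (a : Fin n → Fin n → ℝ → ℝ) (i j : Fin n) (T : ℝ) :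
    equalLimitSolutions a i j →ₗ[ℝ] (Fin n → ℝ) :=
  (LinearMap.proj T).comp (equalLimitSolutions a i j).subtype

/-- Choose solutions linearly in their initial states. By backward uniqueness, passing to the state
at `T` is an injective endomorphism of a finite-dimensional space, hence surjective. -/
lemma range_equalLimitEval_eq_top (ha : IsCoefficients a) (hlb : LocallyBounded a) {i j : Fin n}
    {T : ℝ} (hT : 0 ≤ T) (h : LinearMap.range (equalLimitEval a i j 0) = ⊤) :
    LinearMap.range (equalLimitEval a i j T) = ⊤ := by
  obtain ⟨s, hs⟩ := (equalLimitEval a i j 0).exists_rightInverse_of_surjective h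
  have hinj : Function.Injective ((equalLimitEval a i j T).comp s) := by
    rw [← LinearMap.ker_eq_bot, LinearMap.ker_eq_bot']
    intro v hv
    have h1 : (s v : ℝ → Fin n → ℝ) 0 = 0 :=
      (s v).2.1.initial_eq_zero ha hlb hT hv
    have h2 := LinearMap.congr_fun hs v
    exact h2.symm.trans h1
  have hsurj := LinearMap.injective_iff_surjective.1 hinj
  rw [LinearMap.range_eq_top]
  exact fun v => (hsurj v).imp' s fun w hw => hw

/-- Interactions between different components are integrable. -/
lemma exists_integrableOn_ge_interactions (ha : IsCoefficients a) :
    ∃ φ : ℝ → ℝ, IntegrableOn φ (Ici 0) ∧ ∀ C : Finset (Fin n),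
      (∀ k ∈ C, ∀ l ∉ C,
        weakComponent (unboundedGraph a) k ≠ weakComponent (unboundedGraph a) l) →
      ∀ t, 0 ≤ t → ∀ k ∈ C, ∑ l ∈ Cᶜ, a k l t ≤ φ t := by
  classical
  refine ⟨fun t => ∑ k, ∑ l, if weakComponent (unboundedGraph a) k =
    weakComponent (unboundedGraph a) l then 0 else a k l t, ?_, ?_⟩
  · refine integrable_finsetSum _ fun k _ => integrable_finsetSum _ fun l _ => ?_
    split_ifs with h
    · exact integrable_zero _ _ _
    · refine ⟨(ha.aemeasurable k l).aestronglyMeasurable, ?_⟩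
      rw [hasFiniteIntegral_iff_ofReal]
      · exact lt_top_iff_ne_top.2 fun htop =>
          h (weakComponent_eq_of_adj (G := unboundedGraph a) (u := l) (v := k) htop).symm
      · filter_upwards [ae_restrict_mem measurableSet_Ici] with t ht using ha.nonneg k l t ht
  · intro C hC t ht k hk
    have h0 : ∀ k l, 0 ≤ if weakComponent (unboundedGraph a) k =
        weakComponent (unboundedGraph a) l then 0 else a k l t := fun k l => by
      split_ifs
      · exact le_rfl
      · exact ha.nonneg k l t ht
    refine le_trans ?_ (Finset.single_le_sum (fun k _ => Finset.sum_nonneg fun l _ => h0 k l)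
      (Finset.mem_univ k))
    refine le_trans (Finset.sum_le_sum fun l hl => ?_)
      (Finset.sum_le_sum_of_subset_of_nonneg (Finset.subset_univ Cᶜ) fun l _ _ => h0 k l)
    rw [if_neg (hC k hk l (Finset.mem_compl.1 hl))]

/-- Some initial state is not shared by any solution with equal limits in different components. -/
lemma range_equalLimitEval_ne_top (ha : IsCoefficients a)
    (hlb : LocallyBounded a) {i j : Fin n}
    (hij : weakComponent (unboundedGraph a) i ≠ weakComponent (unboundedGraph a) j) :
    LinearMap.range (equalLimitEval a i j 0) ≠ ⊤ := by
  classical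
  intro htop
  obtain ⟨φ, hφi, hφ⟩ := exists_integrableOn_ge_interactions ha
  have hφint : ∀ s t, 0 ≤ s → 0 ≤ t → IntervalIntegrable φ volume s t := fun s t hs ht =>
    intervalIntegrable_iff.2 (hφi.mono_set fun u hu => (le_min hs ht).trans hu.1.le)
  have hlim := intervalIntegral_tendsto_integral_Ioi 0
    (hφi.mono_set Ioi_subset_Ici_self) tendsto_id
  set L := ∫ τ in Ioi 0, φ τ with hL
  -- Two values within `1 / 6` of the limit differ by at most `1 / 3`, which is the tail bound
  -- needed.
  have hnear := hlim.eventually (Metric.ball_mem_nhds L (by norm_num : (0 : ℝ) < 1 / 6))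
  obtain ⟨T, hTall⟩ := eventually_atTop.1 (hnear.and (eventually_ge_atTop 0))
  have hT : 0 ≤ T := (hTall T le_rfl).2
  have htail : ∀ t, T ≤ t → ∫ τ in T..t, φ τ ≤ 1 / 3 := by
    intro t ht
    have h1 := abs_lt.1 (hTall T le_rfl).1
    have h2 := abs_lt.1 (hTall t ht).1
    have h3 := intervalIntegral.integral_add_adjacent_intervals (hφint 0 T le_rfl hT)
      (hφint T t hT (hT.trans ht))
    simp only [id] at h1 h2
    linarith [h1.1, h2.2]
  set C : Finset (Fin n) := Finset.univ.filter fun k =>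
    weakComponent (unboundedGraph a) k = weakComponent (unboundedGraph a) i with hCdef
  have memC : ∀ k, k ∈ C ↔
      weakComponent (unboundedGraph a) k = weakComponent (unboundedGraph a) i := by simp [hCdef]
  have hcut : ∀ k ∈ C, ∀ l ∉ C,
      weakComponent (unboundedGraph a) k ≠ weakComponent (unboundedGraph a) l := by
    intro k hk l hl h
    rw [memC] at hk hl
    exact hl (h.symm.trans hk)
  have hcut' : ∀ k ∈ Cᶜ, ∀ l ∉ Cᶜ,
      weakComponent (unboundedGraph a) k ≠ weakComponent (unboundedGraph a) l := by
    intro k hk l hl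
    rw [Finset.mem_compl] at hk
    rw [Finset.mem_compl, not_not] at hl
    exact (hcut l hl k hk).symm
  have hrange := range_equalLimitEval_eq_top ha hlb hT htop
  -- The solution with this state at `T` comes from the assumption `htop`, so no existence theorem
  -- is needed.
  obtain ⟨⟨x, hx, hxlim⟩, hxT⟩ :=
    LinearMap.range_eq_top.1 hrange fun k => if k ∈ C then (1 : ℝ) else 0
  replace hxT : ∀ k, x T k = if k ∈ C then (1 : ℝ) else 0 := fun k => congrFun hxT k
  have hx01 : ∀ k, 0 ≤ x T k ∧ x T k ≤ 1 := fun k => by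
    rw [hxT]; split_ifs <;> norm_num
  have hgap : ∀ t, T ≤ t → 1 / 3 ≤ x t i - x t j := by
    intro t ht
    have hφT := hφint T t hT (hT.trans ht)
    have h1 := hx.one_sub_integral_le ha hT ht C hφT
      (fun u hu => hφ C hcut u (hT.trans hu.1)) (fun k => (hx01 k).1) (fun k => (hx01 k).2)
      (fun k hk => by rw [hxT, if_pos hk]) i ((memC i).2 rfl)
    -- Applied to `1 - x` and `Cᶜ`, this gives `x t j ≤ 2 / 3 - 1 / 3`, against `x t i ≥ 2 / 3` from
    -- `h1`.
    have h2 := (hx.affine (-1) 1).one_sub_integral_le ha hT ht Cᶜ hφT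
      (fun u hu => hφ Cᶜ hcut' u (hT.trans hu.1)) (fun k => by linarith [(hx01 k).2])
      (fun k => by linarith [(hx01 k).1])
      (fun k hk => by rw [hxT, if_neg (Finset.mem_compl.1 hk)]; norm_num) j
      (Finset.mem_compl.2 fun h => hij ((memC j).1 h).symm)
    linarith [htail t ht]
  have := ge_of_tendsto hxlim ((eventually_ge_atTop T).mono hgap)
  norm_num at this

/-- A proper subspace is contained in a hyperplane. -/
lemma exists_hyperplane_ge {W : Submodule ℝ (Fin n → ℝ)} (hW : W ≠ ⊤) :
    ∃ V : Submodule ℝ (Fin n → ℝ), Module.finrank ℝ V + 1 = n ∧ W ≤ V := by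
  obtain ⟨f, hf, hWf⟩ := W.exists_le_ker_of_lt_top (lt_top_iff_ne_top.2 hW)
  refine ⟨LinearMap.ker f, ?_, hWf⟩
  have := Module.Dual.finrank_ker_add_one_of_ne_zero hf
  simpa using this

end Consensus

theorem theorem1 {n : ℕ} (a : Fin n → Fin n → ℝ → ℝ)
    (ha : Consensus.IsCoefficients a) (hcb : Consensus.CutBalanced a) :
    -- (a)
    (∀ x : ℝ → Fin n → ℝ, Consensus.IsSolution a x →
      ∀ i, ∃ l ∈ Icc (⨅ j, x 0 j) (⨆ j, x 0 j), Tendsto (fun t => x t i) atTop (𝓝 l)) ∧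
    -- (b)
    (∀ C : Consensus.WeakComponent (Consensus.unboundedGraph a),
      Consensus.StronglyConnectedOn (Consensus.unboundedGraph a) C.supp) ∧
    (Consensus.LocallyBounded a →
      -- (c)
      (∀ x : ℝ → Fin n → ℝ, Consensus.IsSolution a x →
        (∀ i j, IntegrableOn (fun t => a i j t * |x t j - x t i|) (Ici 0)) ∧
        ∀ i j, Consensus.weakComponent (Consensus.unboundedGraph a) i =
            Consensus.weakComponent (Consensus.unboundedGraph a) j →
          ∀ li lj : ℝ, Tendsto (fun t => x t i) atTop (𝓝 li) →
            Tendsto (fun t => x t j) atTop (𝓝 lj) → li = lj) ∧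
      -- (d)
      (∀ i j, Consensus.weakComponent (Consensus.unboundedGraph a) i ≠
          Consensus.weakComponent (Consensus.unboundedGraph a) j →
        ∃ V : Submodule ℝ (Fin n → ℝ), Module.finrank ℝ V + 1 = n ∧
          ∀ x : ℝ → Fin n → ℝ, Consensus.IsSolution a x → x 0 ∉ V →
            ∀ li lj : ℝ, Tendsto (fun t => x t i) atTop (𝓝 li) →
              Tendsto (fun t => x t j) atTop (𝓝 lj) → li ≠ lj)) := by
  refine ⟨fun x hx i => hx.exists_tendsto_mem_Icc ha hcb i,
    fun C => hcb.stronglyConnectedOn_supp ha C, fun hlb => ⟨fun x hx =>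
      ⟨fun i j => hx.integrableOn_interaction ha hcb i j, fun i j hij li lj hi hj =>
        hx.limit_eq_of_weakComponent_eq ha hcb hlb hij hi hj⟩, fun i j hij => ?_⟩⟩
  -- `V` is fixed before any solution: it contains all initial states of solutions with equal limits
  -- at `i` and `j`.
  obtain ⟨V, hV, hWV⟩ := Consensus.exists_hyperplane_ge
    (Consensus.range_equalLimitEval_ne_top ha hlb hij)
  refine ⟨V, hV, fun x hx hxV li lj hi hj hl => hxV (hWV ⟨⟨x, hx, ?_⟩, rfl⟩)⟩
  simpa [hl] using hi.sub hj
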